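/- Let $r\ge 1$, $m\ge 0$ and $a=(a_1,\dots,a_m)\in\mathbf Z^m$. Say that $a$ is *reversible mod $d$* if for some $c\in\mathbf Z$ the multisets $\{a_1+c,\dots,a_m+c\}$ and $\{-a_1,\dots,-a_m\}$ agree mod $d$, and that $a$ is *hereditarily good mod $r$* if for every positive divisor $d$ of $r$, either the entries of $a$ are pairwise distinct mod $d$ or $a$ is reversible mod $d$. For $t\ge 1$ put $q=r^2t$, $\omega_q=e^{2\pi i/q}$, $s_i=rta_i+1$, and let $\mathrm{LMR}(r,t,a)\subset U_{2m}$ be the finite cyclic group generated by the diagonal matrix $$\mathrm{diag}(\omega_q^{s_1},\omega_q^{-s_1},\dots,\omega_q^{s_m},\omega_q^{-s_m}).$$ The Hodge series of a finite group $G\subset U_n$ is the rational function $$\Lambda_G(x,y)=\frac1{|G|}\sum_{g\in G}\frac{\det(I_n+yg)}{\det(I_n-xg)}\in\mathbf C(x,y),$$ and two finite groups $G,H\subset U_n$ are Hodge-equivalent if $\Lambda_G=\Lambda_H$. Suppose that $a$ is hereditarily good mod $r$. Then for every $t\ge 1$ the groups $\mathrm{LMR}(r,t,a)$ and $\mathrm{LMR}(r,t,-a)$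 are Hodge-equivalent. If moreover $a$ is not reversible mod $r$, then for every $t\ge1$ these two groups are not conjugate in $GL_{2m}(\mathbf C)$. -/

import Mathlib

open scoped Matrix

noncomputable section

/-! ### Hodge series of finite groups of unitary matrices -/

/-- Polynomials in two variables `x = X 0`, `y = X 1` over `ℂ`. -/
abbrev PolyXY : Type := MvPolynomial (Fin 2) ℂ

/-- The field `ℂ(x, y)` of rational functions in two variables. -/
abbrev RatXY : Type := FractionRing PolyXY

/-- `det (I + y g)` as a polynomial. -/
def hodgeNum {ι : Type*} [Fintype ι] [DecidableEq ι] (g : Matrix ι ι ℂ) : PolyXY :=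
  (1 + (MvPolynomial.X 1 : PolyXY) • g.map (MvPolynomial.C : ℂ →+* PolyXY)).det

/-- `det (I - x g)` as a polynomial; it is never zero, its constant term being `1`. -/
def hodgeDen {ι : Type*} [Fintype ι] [DecidableEq ι] (g : Matrix ι ι ℂ) : PolyXY :=
  (1 - (MvPolynomial.X 0 : PolyXY) • g.map (MvPolynomial.C : ℂ →+* PolyXY)).det

/-- The Hodge series `(1/|G|) ∑_g det (I + y g) / det (I - x g)` of a finite group of unitary
matrices, as a rational function of `x` and `y`. -/
def hodgeSeries {ι : Type*} [Fintype ι] [DecidableEq ι]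
    (G : Subgroup (Matrix.unitaryGroup ι ℂ)) [Finite G] : RatXY :=
  letI := Fintype.ofFinite G
  (Nat.card G : RatXY)⁻¹ *
    ∑ g : G, algebraMap PolyXY RatXY (hodgeNum (g : Matrix.unitaryGroup ι ℂ).1) /
      algebraMap PolyXY RatXY (hodgeDen (g : Matrix.unitaryGroup ι ℂ).1)

/-- Two finite groups of unitary matrices are Hodge-equivalent if their Hodge series agree. -/
def HodgeEquivalent {ι : Type*} [Fintype ι] [DecidableEq ι]
    (G H : Subgroup (Matrix.unitaryGroup ι ℂ)) [Finite G] [Finite H] : Prop :=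
  hodgeSeries G = hodgeSeries H

/-- Conjugacy of groups of unitary matrices within `GL_n(ℂ)`. -/
def ConjugateInGL {ι : Type*} [Fintype ι] [DecidableEq ι]
    (G H : Subgroup (Matrix.unitaryGroup ι ℂ)) : Prop :=
  ∃ P : GL ι ℂ,
    (fun g : Matrix.unitaryGroup ι ℂ => (P : Matrix ι ι ℂ) * g.1 * ((P⁻¹ : GL ι ℂ) : Matrix ι ι ℂ)) ''
        (G : Set (Matrix.unitaryGroup ι ℂ)) =
      (fun h : Matrix.unitaryGroup ι ℂ => h.1) '' (H : Set (Matrix.unitaryGroup ι ℂ))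

/-! ### Cyclic groups of diagonal matrices -/

/-- `ω_q = exp(2πi/q)`. -/
def rootOmega (q : ℕ) : ℂ := Complex.exp (2 * Real.pi * Complex.I / q)

theorem star_rootOmega_mul (q : ℕ) : star (rootOmega q) * rootOmega q = 1 := by
  rw [rootOmega, Complex.star_def, ← Complex.exp_conj, ← Complex.exp_add]
  have h2 : (starRingEnd ℂ) 2 = 2 := Complex.conj_ofNat 2
  simp [neg_div, h2]

theorem rootOmega_pow (q : ℕ) : rootOmega q ^ q = 1 := by
  rcases Nat.eq_zero_or_pos q with rfl | h
  · simp
  · exact (Complex.isPrimitiveRoot_exp q h.ne').pow_eq_one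

/-- The unitary matrix `diag(ω_q^{s_i})`. -/
def diagOmega {ι : Type*} [Fintype ι] [DecidableEq ι] (q : ℕ) (s : ι → ℤ) :
    Matrix.unitaryGroup ι ℂ :=
  ⟨Matrix.diagonal fun i => rootOmega q ^ s i, by
    rw [Matrix.mem_unitaryGroup_iff', Matrix.star_eq_conjTranspose,
      Matrix.diagonal_conjTranspose, Matrix.diagonal_mul_diagonal, ← Matrix.diagonal_one]
    congr 1
    funext i
    rw [Pi.star_apply, star_zpow₀, ← mul_zpow, star_rootOmega_mul, one_zpow]⟩

/-- The cyclic group `L(q, s)` generated by `diag(ω_q^{s_i})`. -/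
def cyclicL {ι : Type*} [Fintype ι] [DecidableEq ι] (q : ℕ) (s : ι → ℤ) :
    Subgroup (Matrix.unitaryGroup ι ℂ) :=
  Subgroup.zpowers (diagOmega q s)

/-- The doubled list `(s₁, -s₁, …, s_m, -s_m)`; the pair `(i, 0)` indexes `s_i` and
`(i, 1)` indexes `-s_i`. -/
def dub {m : ℕ} (s : Fin m → ℤ) : Fin m × Fin 2 → ℤ :=
  fun p => if p.2 = 0 then s p.1 else -s p.1

/-- `L^±(q, s) = L(q, (s₁, -s₁, …, s_m, -s_m))`, a group of `2m × 2m` unitary matrices. -/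
def cyclicLpm {m : ℕ} (q : ℕ) (s : Fin m → ℤ) :
    Subgroup (Matrix.unitaryGroup (Fin m × Fin 2) ℂ) :=
  cyclicL q (dub s)

/-- `LMR(r, t, a) = L^±(r² t, r t a + 1)`. -/
def LMR {m : ℕ} (r t : ℕ) (a : Fin m → ℤ) :
    Subgroup (Matrix.unitaryGroup (Fin m × Fin 2) ℂ) :=
  cyclicLpm (r ^ 2 * t) fun i => (r : ℤ) * t * a i + 1

instance finite_cyclicL {ι : Type*} [Fintype ι] [DecidableEq ι] (q : ℕ) (s : ι → ℤ) :
    Finite (cyclicL q s) := by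
  have h : ∃ n : ℕ, 0 < n ∧ rootOmega q ^ n = 1 := by
    rcases Nat.eq_zero_or_pos q with rfl | h
    · exact ⟨1, one_pos, by simp [rootOmega]⟩
    · exact ⟨q, h, rootOmega_pow q⟩
  obtain ⟨n, hn, hq⟩ := h
  have key : diagOmega q s ^ n = 1 := by
    apply Subtype.ext
    change (Matrix.diagonal fun i => rootOmega q ^ s i) ^ n = 1
    rw [Matrix.diagonal_pow, ← Matrix.diagonal_one]
    congr 1
    funext i
    rw [Pi.pow_apply, ← zpow_natCast, zpow_comm, zpow_natCast, hq, one_zpow]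
  exact (isOfFinOrder_iff_pow_eq_one.2 ⟨n, hn, key⟩).finite_zpowers

instance finite_LMR {m : ℕ} (r t : ℕ) (a : Fin m → ℤ) : Finite (LMR r t a) :=
  finite_cyclicL _ _

/-! ### Conditions on integer vectors -/

/-- For some integer `c`, `a + c` and `b` are the same as multisets mod `r`. -/
def ShiftEqMod {m : ℕ} (r : ℕ) (a b : Fin m → ℤ) : Prop :=
  ∃ c : ℤ, (Finset.univ.val.map fun i => ((a i + c : ℤ) : ZMod r)) =
    Finset.univ.val.map fun i => ((b i : ℤ) : ZMod r)

/-- The entries of `a` are distinct mod `r`. -/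
def UnivalentMod {m : ℕ} (r : ℕ) (a : Fin m → ℤ) : Prop :=
  Function.Injective fun i => ((a i : ℤ) : ZMod r)

/-- `a` and `-a` agree mod `r` as multisets, up to a common shift. -/
def ReversibleMod {m : ℕ} (r : ℕ) (a : Fin m → ℤ) : Prop :=
  ShiftEqMod r a (-a)

/-- Univalent or reversible mod `r`. -/
def GoodMod {m : ℕ} (r : ℕ) (a : Fin m → ℤ) : Prop :=
  UnivalentMod r a ∨ ReversibleMod r a

/-- Good mod every divisor of `r`. -/
def HereditarilyGoodMod {m : ℕ} (r : ℕ) (a : Fin m → ℤ) : Prop :=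
  ∀ d : ℕ, d ∣ r → GoodMod d a

end

/-! Put `u = rt` in `ZMod q`, so that `u² = 0` and `ru = 0`. The Hodge series is the average over
`k` of `∏ h(ψ(k(1 + u aᵢ)))`, where `h = hodgeFactor` satisfies `h(z) = h(z⁻¹)`. Group the `k` by
the order `n` of `ku`, a divisor of `r`. Within a group, `k ↦ k(1 + uc)` shifts `a` by `c`, and the
product sees `a` only mod `n`; this settles the reversible case (`sum_hodgeFactor_reversible`).

If the `aᵢ` are distinct mod `n`, average over all shifts: for fixed `k` this is a sum over
rotations of `z = ψ(k)` by `n`-th roots of unity. Over the common denominator running through all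
rotations, the numerator is a polynomial in `z` of degree at most `2n` in which only `1, zⁿ, z²ⁿ`
occur, with equal outer coefficients. Hence the average is invariant under `z ↦ z⁻¹`
(`sum_prod_hodgeFactor_inv`), which exchanges `a` and `-a`.

For non-conjugacy, compare eigenvalues. The relevant power is `±(1 + uc)`, and for `rt > 2`
reduction mod `rt` separates the exponents `1 + u aᵢ` from their negatives. What remains is `{aᵢ} =
{c - aᵢ}` mod `r` (`reversibleMod_of_map_dub_eq`). -/

/-! ### Palindromic polynomials -/

section Palindromic

open Polynomial

/-- A polynomial of degree at most `2n`, invariant under `X ↦ ζX` for a primitive `n`-th root of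
unity `ζ`, has only the coefficients of index `0`, `n`, `2n`; it is palindromic as soon as the
outer two agree. -/
theorem eval_eq_pow_mul_eval_inv {K : Type*} [Field K] {n : ℕ} (hn : 0 < n) {ζ : K}
    (hζ : IsPrimitiveRoot ζ n) (Q : K[X]) (hdeg : Q.natDegree ≤ 2 * n)
    (hinv : Q.comp (C ζ * X) = Q) (hcoeff : Q.coeff 0 = Q.coeff (2 * n)) {z : K} (hz : z ≠ 0) :
    Q.eval z = z ^ (2 * n) * Q.eval z⁻¹ := by
  have hzero : ∀ i, ¬ n ∣ i → Q.coeff i = 0 := by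
    intro i hi
    have h := comp_C_mul_X_coeff (p := Q) (r := ζ) (n := i)
    rw [hinv] at h
    by_contra hne
    exact hi ((hζ.pow_eq_one_iff_dvd i).1 (mul_left_cancel₀ hne (by rw [← h, mul_one])))
  rw [eval_eq_sum_range' (Nat.lt_succ_of_le hdeg), eval_eq_sum_range' (Nat.lt_succ_of_le hdeg),
    Finset.mul_sum, ← Finset.sum_range_reflect]
  refine Finset.sum_congr rfl fun i hi => ?_
  have hi' : i ≤ 2 * n := Nat.lt_succ_iff.1 (Finset.mem_range.1 hi)
  have hsub : (2 * n).succ - 1 - i = 2 * n - i := by omega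
  have hc : Q.coeff (2 * n - i) = Q.coeff i := by
    by_cases hd : n ∣ i
    · obtain ⟨k, rfl⟩ := hd
      have hk : k ≤ 2 := by
        by_contra! h
        nlinarith
      interval_cases k
      · simpa using hcoeff.symm
      · congr 1; omega
      · rw [mul_comm n 2, Nat.sub_self, hcoeff]
    · rw [hzero i hd, hzero]
      intro h
      exact hd ((Nat.dvd_sub_iff_right hi' (Dvd.intro_left 2 rfl)).1 h)
  rw [hsub, hc, inv_pow, mul_left_comm]
  congr 1
  rw [← div_eq_mul_inv, eq_div_iff (pow_ne_zero _ hz), ← pow_add, Nat.sub_add_cancel hi']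

/-- The values at `l` and `-l` cancel; without the squares the product can be `-1`. This controls
the top coefficient of a product of rotated quadratics. -/
theorem AddChar.prod_sq_eq_one {A K : Type*} [AddCommGroup A] [Fintype A] [CommMonoid K]
    (χ : AddChar A K) : ∏ l, χ l ^ 2 = 1 := by
  have h : ∏ l, χ (-l) = ∏ l, χ l := Fintype.prod_equiv (Equiv.neg A) _ _ fun _ => rfl
  calc ∏ l, χ l ^ 2 = (∏ l, χ l) * ∏ l, χ (-l) := by
        rw [h, ← Finset.prod_mul_distrib]; simp [sq]
    _ = 1 := by
        rw [← Finset.prod_mul_distrib]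
        refine Finset.prod_eq_one fun l _ => ?_
        rw [← AddChar.map_add_eq_mul, add_neg_cancel, AddChar.map_zero_eq_one]

/-- The average over rotations of a product of rotated palindromic quadratics is palindromic. -/
theorem sum_prod_rotate_eq {K : Type*} [Field K] {n : ℕ} [NeZero n] (χ : AddChar (ZMod n) K)
    (hχ : IsPrimitiveRoot (χ 1) n) (P : ZMod n → K[X]) (hdeg : ∀ l, (P l).natDegree ≤ 2)
    (hP : ∀ l, (P l).coeff 0 = (P l).coeff 2) {z : K} (hz : z ≠ 0) :
    ∑ j, ∏ l, (P l).eval (χ (l + j) * z) =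
      z ^ (2 * n) * ∑ j, ∏ l, (P l).eval (χ (l + j) * z⁻¹) := by
  set Q : K[X] := ∑ j, ∏ l, (P l).comp (C (χ (l + j)) * X) with hQ
  have hev : ∀ w, Q.eval w = ∑ j, ∏ l, (P l).eval (χ (l + j) * w) := fun w => by
    simp [hQ, eval_finsetSum, eval_prod]
  have hd : ∀ j l, ((P l).comp (C (χ (l + j)) * X)).natDegree ≤ 2 := fun j l =>
    natDegree_comp_le.trans ((Nat.mul_le_mul (hdeg l)
      ((natDegree_C_mul_le _ _).trans natDegree_X_le)).trans (by simp))
  have hcard : 2 * n = (Finset.univ : Finset (ZMod n)).card * 2 := by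
    rw [Finset.card_univ, ZMod.card, mul_comm]
  rw [← hev, ← hev]
  refine eval_eq_pow_mul_eval_inv (NeZero.pos n) hχ Q ?_ ?_ ?_ hz
  · refine natDegree_sum_le_of_forall_le _ _ fun j _ => ?_
    rw [hcard]
    exact (natDegree_prod_le _ _).trans (Finset.sum_le_card_nsmul _ _ _ fun l _ => hd j l)
  · rw [hQ, sum_comp]
    -- The rotation by `χ 1` is absorbed by the shift `j ↦ j + 1`.
    refine Fintype.sum_equiv (Equiv.addRight 1) _ _ fun j => ?_
    rw [prod_comp]
    refine Finset.prod_congr rfl fun l _ => ?_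
    rw [comp_assoc]
    congr 1
    simp only [mul_comp, C_comp, X_comp, Equiv.coe_addRight]
    rw [← add_assoc, AddChar.map_add_eq_mul χ (l + j), C_mul, mul_assoc]
  · rw [hQ, finsetSum_coeff, finsetSum_coeff]
    refine Finset.sum_congr rfl fun j _ => ?_
    rw [hcard, coeff_prod_of_natDegree_le _ _ _ fun l _ => hd j l, coeff_zero_eq_eval_zero,
      eval_prod]
    simp only [comp_C_mul_X_coeff, Finset.prod_mul_distrib]
    have h1 : ∏ l, χ (l + j) ^ 2 = 1 := by
      rw [← AddChar.prod_sq_eq_one χ]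
      exact Fintype.prod_equiv (Equiv.addRight j) _ _ fun _ => rfl
    rw [h1, mul_one]
    refine Finset.prod_congr rfl fun l _ => ?_
    rw [← hP, coeff_zero_eq_eval_zero]
    simp

end Palindromic

/-! ### Sums of products of the eigenvalue factors -/

/-- The contribution `(1 + yz)(1 + y/z) / ((1 - xz)(1 - x/z))` of a pair of eigenvalues
`z, z⁻¹` to the Hodge series. -/
noncomputable def hodgeFactor {K : Type*} [Field K] (x y z : K) : K :=
  (1 + y * z) * (1 + y * z⁻¹) / ((1 - x * z) * (1 - x * z⁻¹))

theorem hodgeFactor_inv {K : Type*} [Field K] (x y z : K) :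
    hodgeFactor x y z⁻¹ = hodgeFactor x y z := by
  simp only [hodgeFactor, inv_inv]
  rw [mul_comm (1 + y * z⁻¹), mul_comm (1 - x * z⁻¹)]

/-- Clearing `z⁻¹` leaves a quotient of two palindromic quadratics in `z`. -/
theorem hodgeFactor_eq_div {K : Type*} [Field K] (x y : K) {z : K} (hz : z ≠ 0) :
    hodgeFactor x y z = ((1 + y * z) * (z + y)) / ((1 - x * z) * (z - x)) := by
  have h1 : (1 + y * z) * (1 + y * z⁻¹) = (1 + y * z) * (z + y) * z⁻¹ := by field_simp
  have h2 : (1 - x * z) * (1 - x * z⁻¹) = (1 - x * z) * (z - x) * z⁻¹ := by field_simp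
  rw [hodgeFactor, h1, h2, mul_div_mul_right _ _ (inv_ne_zero hz)]

section Rotation

open Polynomial

/-- For residues `a i` that are distinct mod `n`, the rotation average of the product of the
eigenvalue factors is invariant under `z ↦ z⁻¹`. -/
theorem sum_prod_hodgeFactor_inv {K ι : Type*} [Field K] [CharZero K] [Fintype ι] {n : ℕ}
    [NeZero n] (χ : AddChar (ZMod n) K) (hχ : IsPrimitiveRoot (χ 1) n) (x y : K)
    {a : ι → ZMod n} (ha : Function.Injective a) {z : K} (hz : z ≠ 0)
    (h1 : ∀ l, 1 - x * (χ l * z) ≠ 0) (h2 : ∀ l, χ l * z - x ≠ 0)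
    (h3 : ∀ l, 1 - x * (χ l * z⁻¹) ≠ 0) (h4 : ∀ l, χ l * z⁻¹ - x ≠ 0) :
    ∑ j, ∏ i, hodgeFactor x y (χ (a i + j) * z) =
      ∑ j, ∏ i, hodgeFactor x y (χ (a i + j) * z⁻¹) := by
  classical
  let N : K[X] := (1 + C y * X) * (X + C y)
  let D : K[X] := (1 - C x * X) * (X - C x)
  have hN : N = C y * X ^ 2 + C (1 + y ^ 2) * X + C y := by
    simp only [N, C_add, C_pow, C_1]; ring
  have hD : D = C (-x) * X ^ 2 + C (1 + x ^ 2) * X + C (-x) := by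
    simp only [D, C_add, C_pow, C_1, C_neg]; ring
  have hNd : N.natDegree ≤ 2 := hN ▸ natDegree_quadratic_le
  have hDd : D.natDegree ≤ 2 := hD ▸ natDegree_quadratic_le
  have hNc : N.coeff 0 = N.coeff 2 := by rw [hN]; generalize 1 + y ^ 2 = b; simp [coeff_X]
  have hDc : D.coeff 0 = D.coeff 2 := by rw [hD]; generalize 1 + x ^ 2 = b; simp [coeff_X]
  have hNe : ∀ w, N.eval w = (1 + y * w) * (w + y) := fun w => by simp [N]
  have hDe : ∀ w, D.eval w = (1 - x * w) * (w - x) := fun w => by simp [D]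
  -- Since `a` is injective, each residue is used at most once; the unused residues contribute `D /
  -- D = 1`.
  let P : ZMod n → K[X] := fun l => if l ∈ Finset.univ.image a then N else D
  have hχ0 : ∀ l, χ l ≠ 0 := fun l => by
    intro h
    have := χ.map_add_eq_mul l (-l)
    rw [add_neg_cancel, AddChar.map_zero_eq_one, h, zero_mul] at this
    exact one_ne_zero this
  -- The denominator runs over all residues, so it does not depend on `j`.
  have hrot : ∀ w : K, ∀ j, ∏ l, D.eval (χ (l + j) * w) = ∏ l, D.eval (χ l * w) := fun w j =>
    Fintype.prod_equiv (Equiv.addRight j) _ _ fun _ => rfl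
  have key : ∀ w : K, w ≠ 0 → (∀ l, D.eval (χ l * w) ≠ 0) →
      ∑ j, ∏ i, hodgeFactor x y (χ (a i + j) * w) =
        (∑ j, ∏ l, (P l).eval (χ (l + j) * w)) / ∏ l, D.eval (χ l * w) := by
    intro w hw hDw
    rw [Finset.sum_div]
    refine Finset.sum_congr rfl fun j _ => ?_
    rw [← hrot w j, ← Finset.prod_div_distrib]
    have : ∀ l, (P l).eval (χ (l + j) * w) / D.eval (χ (l + j) * w) =
        if l ∈ Finset.univ.image a then hodgeFactor x y (χ (l + j) * w) else 1 := by
      intro l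
      by_cases hl : l ∈ Finset.univ.image a
      · simp only [P, if_pos hl]
        rw [hodgeFactor_eq_div _ _ (mul_ne_zero (hχ0 _) hw), hNe, hDe]
      · simp only [P, if_neg hl]
        exact div_self (hDw _)
    rw [Finset.prod_congr rfl fun l _ => this l, Finset.prod_ite_mem, Finset.univ_inter,
      Finset.prod_image ha.injOn]
  have hDz : ∀ l, D.eval (χ l * z) ≠ 0 := fun l => by
    rw [hDe]; exact mul_ne_zero (h1 l) (h2 l)
  have hDz' : ∀ l, D.eval (χ l * z⁻¹) ≠ 0 := fun l => by
    rw [hDe]; exact mul_ne_zero (h3 l) (h4 l)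
  rw [key z hz hDz, key z⁻¹ (inv_ne_zero hz) hDz']
  have e1 := sum_prod_rotate_eq χ hχ P (fun l => by simp only [P]; split_ifs <;> assumption)
    (fun l => by simp only [P]; split_ifs <;> assumption) hz
  -- With every factor equal to `D`, the `n` summands coincide; dividing by `n` gives the symmetry
  -- of the denominator.
  have e2 := sum_prod_rotate_eq χ hχ (fun _ => D) (fun _ => hDd) (fun _ => hDc) hz
  simp only [hrot, Finset.sum_const, nsmul_eq_mul] at e2
  rw [mul_left_comm] at e2
  have hn : ((Finset.univ : Finset (ZMod n)).card : K) ≠ 0 := by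
    rw [Finset.card_univ, ZMod.card]
    exact Nat.cast_ne_zero.2 (NeZero.ne n)
  rw [e1, mul_left_cancel₀ hn e2, mul_div_mul_left _ _ (pow_ne_zero _ hz)]

end Rotation

/-! ### The sums attached to `a` and `-a` -/

section TwistedSums

/-- Multiplication by `1 + u c` with `u² = 0` permutes the `k` for which `k u` has order `n`. -/
theorem sum_addOrderOf_eq_twist {M : Type*} [AddCommMonoid M] {q : ℕ} [NeZero q] {u : ZMod q}
    (hu : u * u = 0) (n : ℕ) (c : ℤ) (f : ZMod q → M) :
    ∑ k with addOrderOf (k * u) = n, f (k * (1 + u * c)) =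
      ∑ k with addOrderOf (k * u) = n, f k := by
  have hm : ∀ (k : ZMod q) (c : ℤ), k * (1 + u * c) * u = k * u := fun k c => by
    linear_combination k * c * hu
  have hi : ∀ (k : ZMod q) (c : ℤ), k * (1 + u * c) * (1 + u * (-c : ℤ)) = k := fun k c => by
    push_cast
    linear_combination -k * c * c * hu
  refine Finset.sum_nbij' (fun k => k * (1 + u * c)) (fun k => k * (1 + u * (-c : ℤ)))
    ?_ ?_ ?_ ?_ ?_
  · simp [hm]
  · simp only [Finset.mem_filter, Finset.mem_univ, true_and, hm, imp_self, implies_true]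
  · exact fun k _ => hi k c
  · intro k _
    simpa using hi k (-c)
  · exact fun _ _ => rfl

/-- A function of `k u b`, `b : ℤ`, depends only on `b` modulo the order of `k u`. -/
theorem prod_eq_of_map_eq {M : Type*} [CommMonoid M] {m n q : ℕ} {v : ZMod q}
    (hn : addOrderOf v = n) (f : ZMod q → M) {b b' : Fin m → ℤ}
    (h : (Finset.univ.val.map fun i => ((b i : ℤ) : ZMod n)) =
      Finset.univ.val.map fun i => ((b' i : ℤ) : ZMod n)) :
    ∏ i, f (v * b i) = ∏ i, f (v * b' i) := by
  have hf : Function.FactorsThrough (fun b : ℤ => f (v * b)) (fun b : ℤ => (b : ZMod n)) := by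
    intro b b' hb
    have h1 : (n : ℤ) ∣ b - b' := by
      rw [← ZMod.intCast_zmod_eq_zero_iff_dvd]
      push_cast
      exact sub_eq_zero.2 hb
    obtain ⟨e, he⟩ := h1
    have h2 : v * (n : ℤ) = 0 := by
      have := addOrderOf_nsmul_eq_zero v
      rw [hn, nsmul_eq_mul] at this
      rw [mul_comm]
      exact_mod_cast this
    have h3 : (b : ZMod q) = b' + (n : ℤ) * e := by
      rw [← Int.cast_mul, ← he]; push_cast; ring
    change f (v * b) = f (v * b')
    rw [h3, mul_add, ← mul_assoc, h2, zero_mul, add_zero]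
  -- `f` descends to the residues mod `n`; the default value `1` is never reached, since only casts
  -- of integers occur.
  have key := congrArg (fun s : Multiset (ZMod n) =>
    (s.map (Function.extend (fun b : ℤ => (b : ZMod n)) (fun b : ℤ => f (v * b)) 1)).prod) h
  simp only [Multiset.map_map, Function.comp_def, hf.extend_apply] at key
  exact key

variable {q : ℕ} [NeZero q] {u : ZMod q} {K : Type*} [Field K] (ψ : AddChar (ZMod q) K) (x y : K)

/-- Because `u² = 0`, replacing `k` by `k(1 + uc)` turns `a` into `a + c`. -/
theorem sum_hodgeFactor_reversible {m n : ℕ} (hu : u * u = 0) {a : Fin m → ℤ}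
    (ha : ReversibleMod n a) :
    ∑ k with addOrderOf (k * u) = n, ∏ i, hodgeFactor x y (ψ (k * (u * a i + 1))) =
      ∑ k with addOrderOf (k * u) = n,
        ∏ i, hodgeFactor x y (ψ (k * (u * (-a) i + 1))) := by
  obtain ⟨c, hc⟩ := ha
  rw [← sum_addOrderOf_eq_twist hu n c]
  refine Finset.sum_congr rfl fun k hk => ?_
  have hn := (Finset.mem_filter.1 hk).2
  have key := prod_eq_of_map_eq hn (fun w => hodgeFactor x y (ψ (k + w))) hc
  convert key using 3 with i _ i _
  · congr 1
    push_cast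
    linear_combination k * c * a i * hu
  · congr 1
    ring

theorem sum_hodgeFactor_univalent [CharZero K] {m n : ℕ} (hu : u * u = 0)
    (hψ : Function.Injective ψ) (h1 : ∀ v, 1 - x * ψ v ≠ 0) (h2 : ∀ v, ψ v - x ≠ 0)
    {a : Fin m → ℤ} (ha : UnivalentMod n a) :
    ∑ k with addOrderOf (k * u) = n, ∏ i, hodgeFactor x y (ψ (k * (u * a i + 1))) =
      ∑ k with addOrderOf (k * u) = n,
        ∏ i, hodgeFactor x y (ψ (k * (u * (-a) i + 1))) := by
  rcases Nat.eq_zero_or_pos n with rfl | hpos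
  · refine Finset.sum_congr rfl fun k hk => ?_
    exact absurd (Finset.mem_filter.1 hk).2 (addOrderOf_pos (k * u)).ne'
  have : NeZero n := ⟨hpos.ne'⟩
  have hn0 : (n : K) ≠ 0 := Nat.cast_ne_zero.2 hpos.ne'
  -- All `n` shifts give the same sum, so each sum may be replaced by its average over shifts.
  have havg : ∀ f : ZMod q → K, (n : K) * ∑ k with addOrderOf (k * u) = n, f k =
      ∑ k with addOrderOf (k * u) = n, ∑ j : ZMod n, f (k * (1 + u * (j.val : ℤ))) := by
    intro f
    rw [Finset.sum_comm, Finset.sum_congr rfl fun j _ => sum_addOrderOf_eq_twist hu n _ f]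
    simp
  apply mul_left_cancel₀ hn0
  rw [havg, havg]
  refine Finset.sum_congr rfl fun k hk => ?_
  have hn := (Finset.mem_filter.1 hk).2
  have hnv : (n : ℤ) • (k * u) = 0 := by
    rw [natCast_zsmul, ← hn, addOrderOf_nsmul_eq_zero]
  -- This is `l ↦ ψ(kul)`, well defined because `ku` has order `n`.
  let χ : AddChar (ZMod n) K :=
    ψ.compAddMonoidHom (ZMod.lift n ⟨zmultiplesHom _ (k * u), hnv⟩)
  have hχ : ∀ b : ℤ, χ (b : ZMod n) = ψ (k * u * b) := fun b => by
    simp only [χ, AddChar.compAddMonoidHom_apply, ZMod.lift_coe, zmultiplesHom_apply, zsmul_eq_mul]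
    rw [mul_comm]
  have hχ' : ∀ l, ∃ v, χ l = ψ v := fun l => ⟨_, rfl⟩
  have hprim : IsPrimitiveRoot (χ 1) n := by
    have e : χ 1 = ψ (k * u) := by simpa using hχ 1
    rw [e, IsPrimitiveRoot.iff_def]
    constructor
    · rw [← AddChar.map_nsmul_eq_pow, ← hn, addOrderOf_nsmul_eq_zero, AddChar.map_zero_eq_one]
    · intro l hl
      rw [← AddChar.map_nsmul_eq_pow, ← AddChar.map_zero_eq_one ψ] at hl
      rw [← hn]
      exact addOrderOf_dvd_of_nsmul_eq_zero (hψ hl)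
  have hinv : (ψ k)⁻¹ = ψ (-k) := (AddChar.map_neg_eq_inv ψ k).symm
  have key := sum_prod_hodgeFactor_inv χ hprim x y ha (z := ψ k)
    (fun h => by
      have := ψ.map_add_eq_mul k (-k)
      rw [add_neg_cancel, AddChar.map_zero_eq_one, h, zero_mul] at this
      exact one_ne_zero this)
    (fun l => by obtain ⟨v, hv⟩ := hχ' l; rw [hv, ← AddChar.map_add_eq_mul]; exact h1 _)
    (fun l => by obtain ⟨v, hv⟩ := hχ' l; rw [hv, ← AddChar.map_add_eq_mul]; exact h2 _)
    (fun l => by obtain ⟨v, hv⟩ := hχ' l; rw [hv, hinv, ← AddChar.map_add_eq_mul]; exact h1 _)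
    (fun l => by obtain ⟨v, hv⟩ := hχ' l; rw [hv, hinv, ← AddChar.map_add_eq_mul]; exact h2 _)
  have hcast : ∀ (b : ℤ) (j : ZMod n), (b : ZMod n) + j = ((b + (j.val : ℤ) : ℤ) : ZMod n) :=
    fun b j => by push_cast; rw [ZMod.natCast_zmod_val]
  refine Eq.trans ?_ (key.trans ?_)
  · refine Finset.sum_congr rfl fun j _ => Finset.prod_congr rfl fun i _ => ?_
    rw [hcast, hχ, ← AddChar.map_add_eq_mul]
    congr 2
    push_cast
    linear_combination k * j.val * a i * hu
  -- Inverting the argument of `hodgeFactor` moves the inverse from `ψ k` to `χ`, negating both `aᵢ`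
  -- and `j`.
  · refine Fintype.sum_equiv (Equiv.neg _) _ _ fun j => Finset.prod_congr rfl fun i _ => ?_
    have hneg : χ ((a i : ZMod n) + j) = (ψ (k * u * ((-a i + ((-j).val : ℤ) : ℤ) : ZMod q)))⁻¹ := by
      rw [← hχ, ← hcast, ← AddChar.map_neg_eq_inv χ]
      congr 1
      push_cast
      ring
    rw [hneg, ← mul_inv, hodgeFactor_inv, ← AddChar.map_add_eq_mul]
    congr 2
    simp only [Equiv.neg_apply, Pi.neg_apply]
    push_cast
    linear_combination k * ((-j).val) * a i * hu

/-- For `a` hereditarily good mod `r`, and `u` with `u² = 0` and `r u = 0`, the sums over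
`ZMod q` attached to `a` and `-a` agree. -/
theorem sum_hodgeFactor_neg [CharZero K] {m r : ℕ} (hu : u * u = 0) (hru : (r : ZMod q) * u = 0)
    (hψ : Function.Injective ψ) (h1 : ∀ v, 1 - x * ψ v ≠ 0) (h2 : ∀ v, ψ v - x ≠ 0)
    {a : Fin m → ℤ} (ha : HereditarilyGoodMod r a) :
    ∑ k, ∏ i, hodgeFactor x y (ψ (k * (u * a i + 1))) =
      ∑ k, ∏ i, hodgeFactor x y (ψ (k * (u * (-a) i + 1))) := by
  have hmaps : ∀ k ∈ (Finset.univ : Finset (ZMod q)),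
      addOrderOf (k * u) ∈ Finset.univ.image fun k : ZMod q => addOrderOf (k * u) :=
    fun k hk => Finset.mem_image_of_mem _ hk
  rw [← Finset.sum_fiberwise_of_maps_to hmaps, ← Finset.sum_fiberwise_of_maps_to hmaps]
  refine Finset.sum_congr rfl fun n hn => ?_
  obtain ⟨k, -, rfl⟩ := Finset.mem_image.1 hn
  have hdvd : addOrderOf (k * u) ∣ r :=
    addOrderOf_dvd_of_nsmul_eq_zero (by rw [nsmul_eq_mul, mul_left_comm, hru, mul_zero])
  rcases ha _ hdvd with h | h
  · exact sum_hodgeFactor_univalent ψ x y hu hψ h1 h2 h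
  · exact sum_hodgeFactor_reversible ψ x y hu h

end TwistedSums

/-! ### The groups `L(q, s)` in terms of additive characters -/

theorem rootOmega_zpow_eq_stdAddChar {q : ℕ} [NeZero q] (j : ℤ) :
    rootOmega q ^ j = ZMod.stdAddChar (j : ZMod q) := by
  rw [ZMod.stdAddChar_coe, rootOmega, ← Complex.exp_int_mul]
  congr 1
  ring

theorem coe_diagOmega_zpow {ι : Type*} [Fintype ι] [DecidableEq ι] {q : ℕ} [NeZero q]
    (s : ι → ℤ) (k : ℤ) :
    ((diagOmega q s ^ k : Matrix.unitaryGroup ι ℂ) : Matrix ι ι ℂ) =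
      Matrix.diagonal fun i => ZMod.stdAddChar ((k : ZMod q) * (s i : ZMod q)) := by
  have hnat : ∀ n : ℕ, ((diagOmega q s ^ n : Matrix.unitaryGroup ι ℂ) : Matrix ι ι ℂ) =
      Matrix.diagonal fun i => ZMod.stdAddChar ((n : ZMod q) * (s i : ZMod q)) := by
    intro n
    change (Matrix.diagonal fun i => rootOmega q ^ s i) ^ n = _
    rw [Matrix.diagonal_pow]
    congr 1
    funext i
    rw [Pi.pow_apply, rootOmega_zpow_eq_stdAddChar, ← AddChar.map_nsmul_eq_pow, nsmul_eq_mul]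
  have hq : diagOmega q s ^ q = 1 := by
    apply Subtype.ext
    rw [hnat]
    simp
  have hk : diagOmega q s ^ k = diagOmega q s ^ (k : ZMod q).val := by
    rw [← zpow_natCast, ZMod.val_intCast]
    conv_lhs => rw [← Int.emod_add_mul_ediv k q]
    rw [zpow_add, zpow_mul, zpow_natCast, hq, one_zpow, mul_one]
  rw [hk, hnat, ZMod.natCast_zmod_val]

/-- A unit exponent makes one diagonal entry a primitive `q`-th root of unity. -/
theorem orderOf_diagOmega {ι : Type*} [Fintype ι] [DecidableEq ι] {q : ℕ} [NeZero q]
    (s : ι → ℤ) (i : ι) (hi : IsUnit (s i : ZMod q)) : orderOf (diagOmega q s) = q := by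
  have h : ∀ n : ℕ, diagOmega q s ^ n = 1 ↔ q ∣ n := by
    intro n
    rw [← zpow_natCast, ← Subtype.val_inj, coe_diagOmega_zpow]
    constructor
    · intro h
      have h' := congrFun (congrFun h i) i
      rw [Matrix.diagonal_apply_eq, OneMemClass.coe_one, Matrix.one_apply_eq,
        ← AddChar.map_zero_eq_one (ZMod.stdAddChar (N := q))] at h'
      have := ZMod.injective_stdAddChar h'
      rw [hi.mul_left_eq_zero] at this
      exact (ZMod.natCast_eq_zero_iff n q).1 (by exact_mod_cast this)
    · intro h
      have : ((n : ℤ) : ZMod q) = 0 := by exact_mod_cast (ZMod.natCast_eq_zero_iff n q).2 h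
      simp only [this, zero_mul, AddChar.map_zero_eq_one]
      exact Matrix.diagonal_one
  exact Nat.dvd_antisymm (orderOf_dvd_of_pow_eq_one ((h q).2 dvd_rfl))
    ((h _).1 (pow_orderOf_eq_one _))

/-! ### The Hodge series of `L^±(q, s)` -/

theorem hodgeNum_diagonal {ι : Type*} [Fintype ι] [DecidableEq ι] (d : ι → ℂ) :
    hodgeNum (Matrix.diagonal d) =
      ∏ i, (1 + MvPolynomial.X 1 * (MvPolynomial.C (d i) : PolyXY)) := by
  rw [hodgeNum, Matrix.diagonal_map (map_zero _), ← Matrix.diagonal_smul, ← Matrix.diagonal_one,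
    Matrix.diagonal_add, Matrix.det_diagonal]
  rfl

theorem hodgeDen_diagonal {ι : Type*} [Fintype ι] [DecidableEq ι] (d : ι → ℂ) :
    hodgeDen (Matrix.diagonal d) =
      ∏ i, (1 - MvPolynomial.X 0 * (MvPolynomial.C (d i) : PolyXY)) := by
  rw [hodgeDen, Matrix.diagonal_map (map_zero _), ← Matrix.diagonal_smul, ← Matrix.diagonal_one,
    Matrix.diagonal_sub, Matrix.det_diagonal]
  rfl

/-- The embedding of the constants into `ℂ(x, y)`. -/
noncomputable def constRatXY : ℂ →+* RatXY := (algebraMap PolyXY RatXY).comp MvPolynomial.C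

/-- The character `j ↦ ω_q ^ j` with values in the constants of `ℂ(x, y)`. -/
noncomputable def ratAddChar (q : ℕ) [NeZero q] : AddChar (ZMod q) RatXY :=
  constRatXY.toMonoidHom.compAddChar ZMod.stdAddChar

/-- The variable `x` of `ℂ(x, y)`. -/
noncomputable def ratX : RatXY := algebraMap PolyXY RatXY (MvPolynomial.X 0)

/-- The variable `y` of `ℂ(x, y)`. -/
noncomputable def ratY : RatXY := algebraMap PolyXY RatXY (MvPolynomial.X 1)

theorem ratAddChar_apply {q : ℕ} [NeZero q] (v : ZMod q) :
    ratAddChar q v = algebraMap PolyXY RatXY (MvPolynomial.C (ZMod.stdAddChar v)) := rfl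

theorem ratAddChar_injective (q : ℕ) [NeZero q] : Function.Injective (ratAddChar q) :=
  constRatXY.injective.comp ZMod.injective_stdAddChar

theorem one_sub_ratX_mul_ne_zero (c : ℂ) : 1 - ratX * constRatXY c ≠ 0 := by
  intro h
  have h' : (1 - MvPolynomial.X 0 * MvPolynomial.C c : PolyXY) = 0 := by
    apply IsFractionRing.injective PolyXY RatXY
    rw [map_zero, map_sub, map_one, map_mul]
    exact h
  simpa using congrArg (MvPolynomial.eval 0) h'

theorem const_sub_ratX_ne_zero (c : ℂ) : constRatXY c - ratX ≠ 0 := by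
  intro h
  have h' : (MvPolynomial.C c - MvPolynomial.X 0 : PolyXY) = 0 := by
    apply IsFractionRing.injective PolyXY RatXY
    rw [map_zero, map_sub]
    exact h
  simpa using congrArg (MvPolynomial.eval fun _ => c + 1) h'

instance finite_cyclicLpm {m : ℕ} (q : ℕ) (s : Fin m → ℤ) : Finite (cyclicLpm q s) :=
  finite_cyclicL _ _

/-- The order hypothesis lets `ZMod q` parametrize the group; the coordinates `(i, 0)` and `(i, 1)`
carry inverse eigenvalues and combine into one `hodgeFactor`. -/
theorem hodgeSeries_cyclicLpm {m q : ℕ} [NeZero q] (s : Fin m → ℤ)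
    (hs : orderOf (diagOmega q (dub s)) = q) :
    hodgeSeries (cyclicLpm q s) = (q : RatXY)⁻¹ *
      ∑ k, ∏ i, hodgeFactor ratX ratY (ratAddChar q (k * s i)) := by
  have hcard : Nat.card (cyclicLpm q s) = q := by
    rw [cyclicLpm, cyclicL, Nat.card_zpowers, hs]
  unfold hodgeSeries
  simp only [hcard]
  congr 1
  let := Fintype.ofFinite (cyclicLpm q s)
  symm
  let e : ZMod q → cyclicLpm q s := fun k => ⟨diagOmega q (dub s) ^ k.val, k.val, zpow_natCast _ _⟩
  have he : Function.Bijective e := by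
    refine Function.Injective.bijective_of_nat_card_le ?_ (by rw [hcard, Nat.card_zmod])
    intro k l hkl
    apply ZMod.val_injective q
    have hkl' : diagOmega q (dub s) ^ k.val = diagOmega q (dub s) ^ l.val :=
      congrArg Subtype.val hkl
    exact pow_injOn_Iio_orderOf (by rw [hs]; exact k.val_lt) (by rw [hs]; exact l.val_lt) hkl'
  refine Fintype.sum_bijective e he _ _ fun k => ?_
  have hval : ((e k : Matrix.unitaryGroup (Fin m × Fin 2) ℂ) : Matrix _ _ ℂ) =
      Matrix.diagonal fun p => ZMod.stdAddChar (k * (dub s p : ZMod q)) := by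
    change ((diagOmega q (dub s) ^ k.val : Matrix.unitaryGroup (Fin m × Fin 2) ℂ) :
      Matrix (Fin m × Fin 2) (Fin m × Fin 2) ℂ) = _
    rw [← zpow_natCast, coe_diagOmega_zpow]
    simp
  rw [hval, hodgeNum_diagonal, hodgeDen_diagonal, map_prod, map_prod, ← Finset.prod_div_distrib,
    Fintype.prod_prod_type]
  refine Finset.prod_congr rfl fun i _ => ?_
  have hinv : (ratAddChar q (k * s i))⁻¹ = ratAddChar q (k * (-s i : ℤ)) := by
    rw [← AddChar.map_neg_eq_inv]
    congr 1
    push_cast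
    ring
  rw [hodgeFactor, hinv]
  simp only [Fin.prod_univ_two, dub, if_true, one_ne_zero, if_false,
    ratAddChar_apply, ratX, ratY, map_add, map_sub, map_mul, map_one]
  rw [div_mul_div_comm]

/-! ### Conjugacy -/

/-- Conjugate cyclic diagonal groups have generators with the same eigenvalues, up to replacing
one generator by a power. -/
theorem ConjugateInGL.exists_map_eq {ι : Type*} [Fintype ι] [DecidableEq ι] {q : ℕ} [NeZero q]
    {s s' : ι → ℤ} (h : ConjugateInGL (cyclicL q s) (cyclicL q s')) :
    ∃ k : ZMod q, (Finset.univ.val.map fun i => (s i : ZMod q)) =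
      Finset.univ.val.map fun i => k * (s' i : ZMod q) := by
  obtain ⟨P, hP⟩ := h
  have hmem : (P : Matrix ι ι ℂ) * (diagOmega q s).1 * ((P⁻¹ : GL ι ℂ) : Matrix ι ι ℂ) ∈
      (fun h : Matrix.unitaryGroup ι ℂ => h.1) ''
        (cyclicL q s' : Set (Matrix.unitaryGroup ι ℂ)) := by
    rw [← hP]
    exact ⟨_, Subgroup.mem_zpowers _, rfl⟩
  obtain ⟨_, ⟨k, rfl⟩, hk⟩ := hmem
  refine ⟨k, ?_⟩
  have hc := congrArg (fun M : Matrix ι ι ℂ => M.charpoly.roots) hk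
  have hs : (diagOmega q s).1 = Matrix.diagonal fun i => ZMod.stdAddChar (s i : ZMod q) := by
    simpa using coe_diagOmega_zpow (q := q) s 1
  have hroots : ∀ d : ι → ℂ, (Matrix.diagonal d).charpoly.roots = Finset.univ.val.map d := by
    intro d
    rw [Matrix.charpoly_diagonal, ← Polynomial.roots_multiset_prod_X_sub_C (Finset.univ.val.map d),
      Multiset.map_map]
    rfl
  simp only [Matrix.coe_units_inv, Matrix.charpoly_units_conj, coe_diagOmega_zpow, hs,
    hroots] at hc
  apply Multiset.map_injective (ZMod.injective_stdAddChar (N := q))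
  simp only [Multiset.map_map]
  exact hc.symm

theorem map_univ_prod_fin_two {m : ℕ} {α : Type*} (f : Fin m × Fin 2 → α) :
    Finset.univ.val.map f =
      (Finset.univ.val.map fun i => f (i, 0)) + Finset.univ.val.map fun i => f (i, 1) := by
  have hsum : ∀ {κ : Type} [Fintype κ] (g : κ → α),
      Finset.univ.val.map g = ∑ i, ({g i} : Multiset α) := by
    intro κ _ g
    conv_lhs => rw [← Multiset.sum_map_singleton (Finset.univ.val.map g), Multiset.map_map]
    rfl
  rw [hsum, hsum, hsum, Fintype.sum_prod_type, ← Finset.sum_add_distrib]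
  simp only [Fin.sum_univ_two]

/-- Here `a` and `-a` already agree entrywise, so non-reversibility forces `r > 2`. -/
theorem reversibleMod_of_le_two {m r : ℕ} (hr : 1 ≤ r) (hr2 : r ≤ 2) (a : Fin m → ℤ) :
    ReversibleMod r a := by
  refine ⟨0, Multiset.map_congr rfl fun i _ => ?_⟩
  rw [ZMod.intCast_eq_intCast_iff_dvd_sub]
  have h : -a i - (a i + 0) = 2 * (-a i) := by ring
  rw [Pi.neg_apply, h]
  refine Dvd.dvd.mul_right ?_ _
  interval_cases r <;> norm_num

/-- Equality of the eigenvalue multisets for `a` and a power of the generator for `-a` forces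
`a` to be reversible. -/
theorem reversibleMod_of_map_dub_eq {m r t q : ℕ} (hq : q = r ^ 2 * t) (hr : 2 < r)
    (ht : 1 ≤ t) (a : Fin m → ℤ) (k : ZMod q)
    (h : (Finset.univ.val.map fun p =>
        (dub (fun i => (r : ℤ) * t * a i + 1) p : ZMod q)) =
      Finset.univ.val.map fun p =>
        k * (dub (fun i => (r : ℤ) * t * (-a) i + 1) p : ZMod q)) :
    ReversibleMod r a := by
  rcases Nat.eq_zero_or_pos m with rfl | hm
  · exact ⟨0, by simp⟩
  set u : ZMod q := (r : ZMod q) * t with hu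
  have huu : u * u = 0 := by
    have : ((r ^ 2 * t : ℕ) : ZMod q) = 0 := hq ▸ ZMod.natCast_self q
    push_cast at this
    rw [hu]
    linear_combination t * this
  have hrt : 2 < r * t := by nlinarith
  rw [map_univ_prod_fin_two, map_univ_prod_fin_two] at h
  simp only [dub, if_true, one_ne_zero, if_false, Pi.neg_apply] at h
  push_cast at h
  simp only [← hu] at h
  -- Some `j` gives `1 + u a₀ = ±k(1 - u aⱼ)`, and `1 - u aⱼ` has inverse `1 + u aⱼ`; hence `c = a₀
  -- + aⱼ`.
  have hk : ∃ c : ℤ, k = 1 + u * c ∨ k = -(1 + u * c) := by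
    have hmem : u * a ⟨0, hm⟩ + 1 ∈ (Finset.univ.val.map fun i => u * (a i : ZMod q) + 1) +
        Finset.univ.val.map fun i => -(u * (a i : ZMod q) + 1) :=
      Multiset.mem_add.2 (Or.inl (Multiset.mem_map_of_mem _ (Finset.mem_univ_val _)))
    rw [h, Multiset.mem_add, Multiset.mem_map, Multiset.mem_map] at hmem
    rcases hmem with ⟨j, -, hj⟩ | ⟨j, -, hj⟩
    · refine ⟨a ⟨0, hm⟩ + a j, Or.inl ?_⟩
      push_cast
      linear_combination (1 + u * a j) * hj + (k * a j * a j + a j * a ⟨0, hm⟩) * huu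
    · refine ⟨a ⟨0, hm⟩ + a j, Or.inr ?_⟩
      push_cast
      linear_combination -(1 + u * a j) * hj + (k * a j * a j - a j * a ⟨0, hm⟩) * huu
  obtain ⟨c, hc⟩ := hk
  -- The sign of `k` only exchanges the two halves.
  have h' : ((Finset.univ.val.map fun i => u * (a i : ZMod q) + 1) +
      Finset.univ.val.map fun i => -(u * (a i : ZMod q) + 1)) =
      (Finset.univ.val.map fun i => u * ((c - a i : ℤ) : ZMod q) + 1) +
      Finset.univ.val.map fun i => -(u * ((c - a i : ℤ) : ZMod q) + 1) := by
    rw [h]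
    rcases hc with rfl | rfl
    · congr 1
      · refine Multiset.map_congr rfl fun i _ => ?_
        push_cast
        linear_combination (-c * a i : ZMod q) * huu
      · refine Multiset.map_congr rfl fun i _ => ?_
        push_cast
        linear_combination (c * a i : ZMod q) * huu
    · rw [add_comm]
      congr 1
      · refine Multiset.map_congr rfl fun i _ => ?_
        push_cast
        linear_combination (-c * a i : ZMod q) * huu
      · refine Multiset.map_congr rfl fun i _ => ?_
        push_cast
        linear_combination (c * a i : ZMod q) * huu
  have hdvd : r * t ∣ q := ⟨r, by rw [hq]; ring⟩
  -- Modulo `rt` the two halves become `1` and `-1`, which differ because `rt > 2`.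
  let π : ZMod q →+* ZMod (r * t) := ZMod.castHom hdvd _
  have hπu : π u = 0 := by
    rw [hu, map_mul, map_natCast, map_natCast, ← Nat.cast_mul, ZMod.natCast_self]
  have hne : (-1 : ZMod (r * t)) ≠ 1 := by
    have : Fact (2 < r * t) := ⟨hrt⟩
    exact ZMod.neg_one_ne_one
  have hfilter : ∀ b : Fin m → ℤ, (((Finset.univ.val.map fun i => u * (b i : ZMod q) + 1) +
      Finset.univ.val.map fun i => -(u * (b i : ZMod q) + 1)).filter fun v => π v = 1) =
      Finset.univ.val.map fun i => u * (b i : ZMod q) + 1 := by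
    intro b
    rw [Multiset.filter_add, Multiset.filter_eq_self.2, Multiset.filter_eq_nil.2, add_zero]
    · intro v hv
      obtain ⟨i, -, rfl⟩ := Multiset.mem_map.1 hv
      simpa [hπu] using hne
    · intro v hv
      obtain ⟨i, -, rfl⟩ := Multiset.mem_map.1 hv
      simp [hπu]
  have hmain : (Finset.univ.val.map fun i => u * (a i : ZMod q) + 1) =
      Finset.univ.val.map fun i => u * ((c - a i : ℤ) : ZMod q) + 1 := by
    rw [← hfilter a, ← hfilter fun i => c - a i, h']
  -- As `q = r · rt`, the class of `ub + 1` mod `q` determines `b` mod `r`.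
  have hf : Function.FactorsThrough (fun b : ℤ => ((b - c : ℤ) : ZMod r))
      (fun b : ℤ => u * (b : ZMod q) + 1) := by
    intro b b' hb
    have h1 : (((r * t : ℕ) * (b' - b) : ℤ) : ZMod q) = 0 := by
      push_cast
      rw [← hu]
      linear_combination -hb
    rw [ZMod.intCast_zmod_eq_zero_iff_dvd] at h1
    have h2 : ((q : ℕ) : ℤ) = (r * t : ℕ) * r := by rw [hq]; push_cast; ring
    rw [h2] at h1
    have h3 := Int.dvd_of_mul_dvd_mul_left (by exact_mod_cast (show r * t ≠ 0 by omega)) h1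
    change ((b - c : ℤ) : ZMod r) = ((b' - c : ℤ) : ZMod r)
    rw [ZMod.intCast_eq_intCast_iff_dvd_sub]
    simpa using h3
  have key := congrArg (Multiset.map (Function.extend (fun b : ℤ => u * (b : ZMod q) + 1)
    (fun b : ℤ => ((b - c : ℤ) : ZMod r)) 0)) hmain
  simp only [Multiset.map_map, Function.comp_def, hf.extend_apply] at key
  -- Subtracting `c` from `c - aᵢ` leaves `-aᵢ`.
  refine ⟨-c, ?_⟩
  refine Eq.trans ?_ (key.trans ?_) <;> refine Multiset.map_congr rfl fun i _ => ?_
  · rw [sub_eq_add_neg]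
  · rw [Pi.neg_apply, sub_sub_cancel_left]

/-! ### Hodge equivalence and non-conjugacy -/

theorem theorem1 {m : ℕ} (r : ℕ) (hr : 1 ≤ r) (a : Fin m → ℤ)
    (ha : HereditarilyGoodMod r a) (t : ℕ) (ht : 1 ≤ t) :
    HodgeEquivalent (LMR r t a) (LMR r t (-a)) ∧
      (¬ ReversibleMod r a → ¬ ConjugateInGL (LMR r t a) (LMR r t (-a))) := by
  have : NeZero (r ^ 2 * t) := ⟨by positivity⟩
  refine ⟨?_, fun hrev hconj => ?_⟩
  -- For `m = 0` the group is trivial and need not have order `q`.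
  · rcases Nat.eq_zero_or_pos m with rfl | hm
    · rw [Subsingleton.elim (-a) a]
      rfl
    set q := r ^ 2 * t with hq
    have hzero : (r : ZMod q) * (r * t) = 0 := by
      have : ((r ^ 2 * t : ℕ) : ZMod q) = 0 := ZMod.natCast_self q
      push_cast at this
      linear_combination this
    have huu : ((r : ZMod q) * t) * (r * t) = 0 := by linear_combination t * hzero
    have hord : ∀ b : Fin m → ℤ,
        orderOf (diagOmega q (dub fun i => (r : ℤ) * t * b i + 1)) = q := by
      intro b
      refine orderOf_diagOmega _ (⟨0, hm⟩, 0) ?_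
      -- As `u² = 0`, the inverse of `1 + ub` is `1 - ub`.
      refine IsUnit.of_mul_eq_one (1 - (r : ZMod q) * t * b ⟨0, hm⟩) ?_
      simp only [dub, if_true]
      push_cast
      linear_combination (-b ⟨0, hm⟩ ^ 2 : ZMod q) * huu
    have hser : ∀ b : Fin m → ℤ, hodgeSeries (LMR r t b) = (q : RatXY)⁻¹ *
        ∑ k, ∏ i, hodgeFactor ratX ratY (ratAddChar q (k * ((r : ZMod q) * t * b i + 1))) := by
      intro b
      refine (hodgeSeries_cyclicLpm _ (hord b)).trans ?_
      push_cast
      rfl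
    rw [HodgeEquivalent, hser, hser, sum_hodgeFactor_neg (ratAddChar q) ratX ratY huu hzero
      (ratAddChar_injective q) (fun v => one_sub_ratX_mul_ne_zero _)
      (fun v => const_sub_ratX_ne_zero _) ha]
  · obtain ⟨k, hk⟩ := hconj.exists_map_eq
    rcases Nat.lt_or_ge 2 r with h2 | h2
    · exact hrev (reversibleMod_of_map_dub_eq rfl h2 ht a k hk)
    · exact hrev (reversibleMod_of_le_two hr h2 a)
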